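/- Let $n\ge 1$ and identify a bit string $a=(a_0,\dots,a_{n-1})\in\{0,1\}^n$ with the integer $\sum_i a_i2^i$. For $c\in\{0,1\}^n$, the $n$-bit classical--quantum comparator with constant $c$ is the operator on $n+1$ qubits with $$|a\rangle|z\rangle\mapsto|a\rangle|z\oplus(c<a)\rangle\qquad(a\in\{0,1\}^n,\ z\in\{0,1\}),$$ where $(c<a)$ is $1$ if $c<a$ and $0$ otherwise. A dirty ancilla is an additional qubit that may start in an arbitrary state and must be returned to that same state; a clean ancilla starts in $|0\rangle$ and must be returned to $|0\rangle$. The depth of a circuit is its number of time steps when every gate is executed as early as possible and gates acting on disjoint sets of qubits may be executed in the same step. Theorem. For every classical constant $c$, the $n$-bit classical--quantum comparator can be implemented over the gate set $\{CCX,CX,X\}$ with $\Theta(n)$ gates and $\Theta(\log n)$ depth, using one dirty ancilla qubit, and these orders are optimal for the worst-case constant. Precisely, there are absolute constants $k,K>0$ such that for every $n\ge1$: 1. for every $c\in\{0,1\}^n$ there is a circuit over $\{CCX,CX,X\}$ on $n+2$ qubits (the $n$ input qubits, the target qubit and one dirty ancilla) that implements the comparator with constant $c$ exactly, whose number of gates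 lies between $kn$ and $Kn$, and, if $n\ge2$, whose depth lies between $k\log_2 n$ and $K\log_2 n$; 2. there is a $c\in\{0,1\}^n$ such that every circuit over $\{CCX,CX,X\}$ that implements the comparator with constant $c$ exactly, with any number of clean ancilla qubits, has at least $kn$ gates and depth at least $k\log_2 n$. (In particular this holds for circuits using dirty ancilla qubits.) -/

import Mathlib

namespace QCircuit

/-- Pure states (not necessarily normalised) of a register whose qubits are labelled by `W`:
amplitude vectors indexed by the computational basis `W → Bool`. -/
abbrev State (W : Type) : Type := (W → Bool) → ℂ

/-- Linear operators on such a register, as matrices in the computational basis. -/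
abbrev Op (W : Type) : Type := Matrix (W → Bool) (W → Bool) ℂ

/-- The computational basis state `|x⟩`. -/
def ket {W : Type} [Fintype W] [DecidableEq W] (x : W → Bool) : State W :=
  Pi.single x 1

/-- The product state `ψ ⊗ φ` of two registers. -/
def tensor {W A : Type} (ψ : State W) (φ : State A) : State (W ⊕ A) :=
  fun s => ψ (fun w => s (Sum.inl w)) * φ (fun a => s (Sum.inr a))

/-- The operator that maps `|x⟩` to `|f x⟩` for every `x`. -/
def opOfMap {W : Type} [Fintype W] [DecidableEq W] (f : (W → Bool) → (W → Bool)) : Op W :=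
  Matrix.of fun y x => if y = f x then 1 else 0

/-- The gate set `{CCX, CX, X}` on qubits labelled by `W`. The wires of a gate are distinct,
and its target is the last one. -/
inductive Gate (W : Type) : Type
  | X (t : W) : Gate W
  | CX (c t : W) (hct : c ≠ t) : Gate W
  | CCX (c₁ c₂ t : W) (hcc : c₁ ≠ c₂) (h₁ : c₁ ≠ t) (h₂ : c₂ ≠ t) : Gate W

namespace Gate

variable {W : Type} [DecidableEq W]

/-- The action of a gate on computational basis labels. -/
def act : Gate W → (W → Bool) → (W → Bool)
  | X t, x => Function.update x t (xor (x t) true)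
  | CX c t _, x => Function.update x t (xor (x t) (x c))
  | CCX c₁ c₂ t _ _ _, x => Function.update x t (xor (x t) (x c₁ && x c₂))

/-- The qubits on which a gate acts. -/
def wires : Gate W → Finset W
  | X t => {t}
  | CX c t _ => {c, t}
  | CCX c₁ c₂ t _ _ _ => {c₁, c₂, t}

/-- The unitary operator of a gate. -/
def op [Fintype W] (g : Gate W) : Op W := opOfMap g.act

end Gate

/-- A quantum circuit over `{CCX, CX, X}`: its gates in the order of application. -/
abbrev Circuit (W : Type) : Type := List (Gate W)

namespace Circuit

variable {W : Type} [DecidableEq W]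

/-- The operator of a circuit; the head of the list is applied first. -/
def op [Fintype W] : Circuit W → Op W
  | [] => 1
  | g :: C => op C * g.op

/-- The number of gates. -/
def gateCount (C : Circuit W) : ℕ := C.length

/-- Given for each qubit the last time step at which it is busy, schedule a further gate at the
earliest possible time step: one after the latest step at which one of its qubits is busy. -/
def schedule (busy : W → ℕ) (g : Gate W) : W → ℕ :=
  fun w => if w ∈ g.wires then g.wires.sup busy + 1 else busy w

/-- The circuit depth: the number of time steps when every gate is executed as early as possible,
gates on disjoint sets of qubits being allowed in the same time step. -/
def depth [Fintype W] (C : Circuit W) : ℕ :=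
  Finset.univ.sup (C.foldl schedule (fun _ => 0))

end Circuit

/-- `C` implements the operator `V` on the register `W` using the register `A` as dirty ancilla
qubits: they may start in an arbitrary state, and that state is restored. -/
def ImplementsWithDirty {W A : Type} [Fintype W] [DecidableEq W] [Fintype A] [DecidableEq A]
    (C : Circuit (W ⊕ A)) (V : Op W) : Prop :=
  ∀ (ψ : State W) (φ : State A),
    (Circuit.op C).mulVec (tensor ψ φ) = tensor (V.mulVec ψ) φ

/-- `C` implements the operator `V` on the register `W` using the register `A` as clean ancilla
qubits: they start in the state `|0…0⟩` and are returned to it. -/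
def ImplementsWithClean {W A : Type} [Fintype W] [DecidableEq W] [Fintype A] [DecidableEq A]
    (C : Circuit (W ⊕ A)) (V : Op W) : Prop :=
  ∀ ψ : State W,
    (Circuit.op C).mulVec (tensor ψ (ket fun _ => false)) =
      tensor (V.mulVec ψ) (ket fun _ => false)

/-- The qubits `|a⟩|z⟩` of an `n`-bit classical-quantum comparator: `n` input qubits and one
target qubit. -/
abbrev CmpWires (n : ℕ) : Type := Fin n ⊕ Unit

/-- The `n`-bit classical-quantum comparator `|a⟩|z⟩ ↦ |a⟩|z ⊕ (c < a)⟩` for the constant `c`.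
Bit strings are compared as binary numbers, bit `i` having weight `2 ^ i`. -/
def cqComparator (n : ℕ) (c : Fin n → Bool) : Op (CmpWires n) :=
  opOfMap fun s =>
    Function.update s (Sum.inr ())
      (xor (s (Sum.inr ())) (decide (Nat.ofBits c < Nat.ofBits fun i => s (Sum.inl i))))

end QCircuit

/-! Every gate permutes the computational basis, so all claims reduce to maps of bit strings.

Upper bound: read the most significant bits first. If some leading bits differ from those of `c`,
they decide the comparison. If they agree, their contents are known, so these input wires can serve
as clean workspace for the remaining bits. `exists_compare_circuit` makes this a divide and conquer:
six leading wires are compared by brute force (`exists_xor_circuit`) and then lent to the two halves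
of the rest, which run in parallel; a flag masks the results when the leading bits disagree. Each
level adds constant depth and uses up six wires, whence logarithmic depth and linear size.
`exists_comparator_circuit` removes the garbage by running the circuit backwards and cancels the
unknown value of the dirty wire by applying the computation twice, before and after toggling that
wire.

Lower bound: gates have at most three wires, so a wire depends on at most `3 ^ t` inputs after `t`
steps, and on at most three new ones per gate. For `c = 2 ^ n - 2` the target depends on all `n`
inputs (`card_le_of_depends`). -/

namespace QCircuit

/-! ### Gates as local involutions on basis labels. -/

namespace Gate

variable {W : Type} [DecidableEq W]

theorem act_of_notMem (g : Gate W) (x : W → Bool) {w : W} (hw : w ∉ g.wires) :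
    g.act x w = x w := by
  cases g <;> simp_all [act, wires]

theorem act_congr (g : Gate W) {x y : W → Bool} (h : ∀ w ∈ g.wires, x w = y w) :
    ∀ w ∈ g.wires, g.act x w = g.act y w := by
  intro w hw
  have hxy := h w hw
  cases g <;> simp only [wires, Finset.mem_insert, Finset.mem_singleton, forall_eq_or_imp,
    forall_eq] at h <;> simp only [act, Function.update_apply] <;> split_ifs <;>
    simp_all [wires]

theorem act_act (g : Gate W) (x : W → Bool) : g.act (g.act x) = x := by
  cases g <;> funext w <;> simp_all [act, Function.update_apply]

theorem card_wires_le (g : Gate W) : g.wires.card ≤ 3 := by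
  cases g
  · simp [wires]
  · exact Finset.card_le_two.trans (by norm_num)
  · exact Finset.card_le_three

end Gate

/-! ### Supports of circuits, and depth bounds that compose in sequence and in parallel. -/

namespace Circuit

variable {W : Type} [DecidableEq W]

/-- The action of a circuit on computational basis labels. -/
def act (C : Circuit W) (x : W → Bool) : W → Bool := C.foldl (fun y g => g.act y) x

@[simp] theorem act_nil (x : W → Bool) : act [] x = x := rfl

@[simp] theorem act_cons (g : Gate W) (C : Circuit W) (x : W → Bool) :
    act (g :: C) x = act C (g.act x) := rfl

@[simp] theorem act_append (C D : Circuit W) (x : W → Bool) :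
    act (C ++ D) x = act D (act C x) := by
  simp [act]

theorem act_reverse_act (C : Circuit W) (x : W → Bool) : act C.reverse (act C x) = x := by
  induction C generalizing x with
  | nil => rfl
  | cons g C ih => simp [ih, Gate.act_act]

/-- All gates of the circuit act on wires in the list `S`. -/
def SupportedOn (C : Circuit W) (S : List W) : Prop := ∀ g ∈ C, ∀ w ∈ g.wires, w ∈ S

namespace SupportedOn

variable {C D : Circuit W} {S S' : List W}

theorem mono (h : SupportedOn C S) (hS : S ⊆ S') : SupportedOn C S' :=
  fun g hg w hw => hS (h g hg w hw)

theorem append (hC : SupportedOn C S) (hD : SupportedOn D S) : SupportedOn (C ++ D) S := by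
  intro g hg
  rcases List.mem_append.1 hg with h | h
  exacts [hC g h, hD g h]

theorem reverse (hC : SupportedOn C S) : SupportedOn C.reverse S :=
  fun g hg => hC g (List.mem_reverse.1 hg)

theorem act_of_notMem (h : SupportedOn C S) (x : W → Bool) {w : W} (hw : w ∉ S) :
    act C x w = x w := by
  induction C generalizing x with
  | nil => rfl
  | cons g C ih =>
    rw [act_cons, ih (fun g hg => h g (List.mem_cons_of_mem _ hg)),
      g.act_of_notMem x fun hg => hw (h g List.mem_cons_self w hg)]

theorem act_congr (h : SupportedOn C S) {x y : W → Bool} (hxy : ∀ w ∈ S, x w = y w) :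
    ∀ w ∈ S, act C x w = act C y w := by
  induction C generalizing x y with
  | nil => exact hxy
  | cons g C ih =>
    refine ih (fun g hg => h g (List.mem_cons_of_mem _ hg)) fun w hw => ?_
    change g.act x w = g.act y w
    by_cases hg : w ∈ g.wires
    · exact g.act_congr (fun v hv => hxy v (h g List.mem_cons_self v hv)) w hg
    · rw [g.act_of_notMem x hg, g.act_of_notMem y hg, hxy w hw]

theorem act_update (h : SupportedOn C S) (x : W → Bool) {z : W} (hz : z ∉ S) (b : Bool) :
    act C (Function.update x z b) = Function.update (act C x) z b := by
  funext w
  by_cases hw : w ∈ S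
  · have hwz : w ≠ z := fun e => hz (e ▸ hw)
    rw [Function.update_of_ne hwz]
    exact h.act_congr (fun v hv => Function.update_of_ne (by rintro rfl; exact hz hv) _ _) w hw
  · by_cases hwz : w = z
    · subst hwz
      simp [h.act_of_notMem _ hw]
    · simp [h.act_of_notMem _ hw, hwz]

theorem foldl_schedule_of_notMem (h : SupportedOn C S) (busy : W → ℕ) {w : W} (hw : w ∉ S) :
    C.foldl schedule busy w = busy w := by
  induction C generalizing busy with
  | nil => rfl
  | cons g C ih =>
    rw [List.foldl_cons, ih (fun g hg => h g (List.mem_cons_of_mem _ hg)), schedule,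
      if_neg fun hg => hw (h g List.mem_cons_self w hg)]

end SupportedOn

/-- The circuit lives on the wires in `S` and keeps them busy for at most `d` more steps. -/
structure BusyLE (C : Circuit W) (S : List W) (d : ℕ) : Prop where
  supp : SupportedOn C S
  busy : ∀ (b : W → ℕ) (m : ℕ), (∀ w ∈ S, b w ≤ m) → ∀ w ∈ S, C.foldl schedule b w ≤ m + d

namespace BusyLE

variable {C D : Circuit W} {S S' : List W} {d e : ℕ}

theorem mono (h : BusyLE C S d) (hS : S ⊆ S') (hd : d ≤ e) : BusyLE C S' e := by
  refine ⟨h.supp.mono hS, fun b m hb w hw => ?_⟩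
  by_cases hwS : w ∈ S
  · exact (h.busy b m (fun v hv => hb v (hS hv)) w hwS).trans (by omega)
  · rw [h.supp.foldl_schedule_of_notMem b hwS]
    exact (hb w hw).trans (by omega)

theorem append (hC : BusyLE C S d) (hD : BusyLE D S e) : BusyLE (C ++ D) S (d + e) := by
  refine ⟨hC.supp.append hD.supp, fun b m hb w hw => ?_⟩
  rw [List.foldl_append, ← add_assoc]
  exact hD.busy _ _ (hC.busy b m hb) w hw

/-- Disjoint supports mean that neither circuit changes the busy times seen by the other, so the
delays do not add. -/
theorem parallel (hC : BusyLE C S d) (hD : BusyLE D S' d) (hS : S.Disjoint S') :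
    BusyLE (C ++ D) (S ++ S') d := by
  refine ⟨(hC.supp.mono (List.subset_append_left _ _)).append
    (hD.supp.mono (List.subset_append_right _ _)), fun b m hb w hw => ?_⟩
  rw [List.foldl_append]
  by_cases hwD : w ∈ S'
  · refine hD.busy _ m (fun v hv => ?_) w hwD
    rw [hC.supp.foldl_schedule_of_notMem b fun h => hS h hv]
    exact hb v (List.mem_append_right _ hv)
  · rw [hD.supp.foldl_schedule_of_notMem _ hwD]
    exact hC.busy b m (fun v hv => hb v (List.mem_append_left _ hv)) w
      ((List.mem_append.1 hw).resolve_right hwD)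

theorem of_length_le (hC : SupportedOn C S) (hd : C.length ≤ d) : BusyLE C S d := by
  refine BusyLE.mono (d := C.length) ⟨hC, ?_⟩ (List.Subset.refl _) hd
  clear hd
  induction C with
  | nil => exact fun b m hb w hw => hb w hw
  | cons g C ih =>
    intro b m hb w hw
    rw [List.length_cons, add_comm C.length, ← add_assoc]
    refine ih (fun g hg => hC g (List.mem_cons_of_mem _ hg)) _ _ (fun v hv => ?_) w hw
    unfold schedule
    split_ifs
    · exact Nat.succ_le_succ (Finset.sup_le fun u hu => hb u (hC g List.mem_cons_self u hu))
    · exact (hb v hv).trans (Nat.le_succ m)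

theorem depth_le [Fintype W] (h : BusyLE C S d) : depth C ≤ d := by
  refine Finset.sup_le fun w _ => ?_
  by_cases hw : w ∈ S
  · simpa using h.busy (fun _ => 0) 0 (fun _ _ => le_rfl) w hw
  · rw [h.supp.foldl_schedule_of_notMem _ hw]
    exact Nat.zero_le d

end BusyLE

/-- The circuit and its reversal have depth at most `d` on the wires in `S`. -/
structure DepthLE (C : Circuit W) (S : List W) (d : ℕ) : Prop where
  fwd : BusyLE C S d
  bwd : BusyLE C.reverse S d

namespace DepthLE

variable {C D : Circuit W} {S S' : List W} {d e : ℕ}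

theorem supp (h : DepthLE C S d) : SupportedOn C S := h.fwd.supp

theorem mono (h : DepthLE C S d) (hS : S ⊆ S') (hd : d ≤ e) : DepthLE C S' e :=
  ⟨h.fwd.mono hS hd, h.bwd.mono hS hd⟩

theorem append (hC : DepthLE C S d) (hD : DepthLE D S e) : DepthLE (C ++ D) S (d + e) := by
  refine ⟨hC.fwd.append hD.fwd, ?_⟩
  rw [List.reverse_append, add_comm]
  exact hD.bwd.append hC.bwd

theorem parallel (hC : DepthLE C S d) (hD : DepthLE D S' d) (hS : S.Disjoint S') :
    DepthLE (C ++ D) (S ++ S') d := by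
  refine ⟨hC.fwd.parallel hD.fwd hS, ?_⟩
  rw [List.reverse_append]
  exact (hD.bwd.parallel hC.bwd hS.symm).mono (by simp) le_rfl

theorem reverse (h : DepthLE C S d) : DepthLE C.reverse S d :=
  ⟨h.bwd, by simpa using h.fwd⟩

theorem of_length_le (hC : SupportedOn C S) (hd : C.length ≤ d) : DepthLE C S d :=
  ⟨.of_length_le hC hd, .of_length_le hC.reverse (by simpa using hd)⟩

end DepthLE

/-! ### Brute-force circuits for functions of few wires. -/

/-- Every Boolean function of the wires in `T` can be added to the wire `t` using one dirty
wire `d`. -/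
theorem exists_xor_circuit (T : List W) (t d : W) (hT : (t :: d :: T).Nodup)
    (g : (W → Bool) → Bool) (hg : ∀ x y : W → Bool, (∀ w ∈ T, x w = y w) → g x = g y) :
    ∃ C : Circuit W, SupportedOn C (t :: d :: T) ∧ C.length + 1 ≤ 2 * 3 ^ T.length ∧
      ∀ x, act C x = Function.update x t (xor (x t) (g x)) := by
  induction T generalizing t d g with
  | nil =>
    have hc : ∀ x, g x = g fun _ => false := fun x => hg _ _ (by simp)
    cases h : g fun _ => false
    · exact ⟨[], by simp [SupportedOn], by simp, fun x => by simp [hc x, h]⟩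
    · exact ⟨[.X t], by simp [SupportedOn, Gate.wires], by simp,
        fun x => by simp [hc x, h, Gate.act]⟩
  | cons w T ih =>
    simp only [List.nodup_cons, List.mem_cons, not_or] at hT
    obtain ⟨⟨htd, htw, htT⟩, ⟨hdw, hdT⟩, hwT, hTn⟩ := hT
    have hu : ∀ b, ∀ x y : W → Bool, (∀ v ∈ T, x v = y v) →
        g (Function.update x w b) = g (Function.update y w b) := by
      refine fun b x y hxy => hg _ _ fun v hv => ?_
      rcases List.mem_cons.1 hv with rfl | hv
      · simp
      · have : v ≠ w := fun e => hwT (e ▸ hv)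
        simp [this, hxy v hv]
    obtain ⟨C₀, hs₀, hl₀, ha₀⟩ := ih t d (by simp_all) (fun x => g (Function.update x w false))
      (hu false)
    -- The roles of target and dirty wire are exchanged here.
    obtain ⟨C₁, hs₁, hl₁, ha₁⟩ := ih d t (by simp_all [Ne.symm htd])
      (fun x => xor (g (Function.update x w false)) (g (Function.update x w true)))
      (fun x y hxy => by rw [hu false x y hxy, hu true x y hxy])
    have hG : SupportedOn [Gate.CCX d w t hdw (Ne.symm htd) (Ne.symm htw)] (t :: d :: w :: T) := by
      simp [SupportedOn, Gate.wires]
    have hs₀' := hs₀.mono (S' := t :: d :: w :: T) (by intro v; simp; tauto)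
    have hs₁' := hs₁.mono (S' := t :: d :: w :: T) (by intro v; simp; tauto)
    -- Shannon expansion `g = g₀ ⊕ w·(g₀ ⊕ g₁)`. The product is added by two `CCX` gates, one with
    -- `d` toggled by `g₀ ⊕ g₁` and one with `d` restored, so the unknown `d` cancels.
    refine ⟨C₀ ++ (C₁ ++ ([Gate.CCX d w t hdw (Ne.symm htd) (Ne.symm htw)] ++
      (C₁ ++ [Gate.CCX d w t hdw (Ne.symm htd) (Ne.symm htw)]))),
      hs₀'.append (hs₁'.append (hG.append (hs₁'.append hG))), ?_, fun x => ?_⟩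
    -- Length plus one satisfies `ℓ = ℓ₀ + 2ℓ₁`, hence the factor 3 per wire.
    · simp only [List.length_append, List.length_cons, List.length_nil, pow_succ]
      omega
    · have hgx : g x = xor (g (Function.update x w false))
          (x w && xor (g (Function.update x w false)) (g (Function.update x w true))) := by
        have : g x = g (Function.update x w (x w)) := by rw [Function.update_eq_self]
        rw [this]
        cases x w <;> simp
      have hind : ∀ (b : Bool) (y : W → Bool) (v : W) (e : Bool), v ∉ T → v ≠ w →
          g (Function.update (Function.update y v e) w b) = g (Function.update y w b) := by
        refine fun b y v e hv _ => hu b _ _ fun u hu' => ?_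
        rw [Function.update_of_ne (by rintro rfl; exact hv hu')]
      rw [hgx]
      simp only [act_append, act_cons, act_nil, ha₀, ha₁, Gate.act]
      simp only [hind _ _ _ _ htT htw, hind _ _ _ _ hdT hdw]
      generalize g (Function.update x w false) = p
      generalize g (Function.update x w true) = q
      funext v
      have htd' := Ne.symm htd
      have htw' := Ne.symm htw
      have hdw' := Ne.symm hdw
      by_cases h1 : v = t
      · subst h1
        simp [*]
        cases x v <;> cases x d <;> cases x w <;> cases p <;> cases q <;> rfl
      · by_cases h2 : v = d
        · subst h2
          simp [*]
        · simp [*]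

end Circuit

end QCircuit

/-! ### Logarithmic-depth comparison with input wires as workspace. -/

namespace QCircuit

namespace Circuit

variable {W : Type}

/-- Comparison of the register `L` (most significant wire first) with the constant `c`:
whether the content of the register is larger than the constant. -/
def gtOn (c : W → Bool) : List W → (W → Bool) → Bool
  | [], _ => false
  | w :: L, x => if x w = c w then gtOn c L x else x w

/-- Whether the register `L` contains the constant `c`. -/
def eqOn (c : W → Bool) : List W → (W → Bool) → Bool
  | [], _ => true
  | w :: L, x => if x w = c w then eqOn c L x else false

theorem eqOn_iff (c : W → Bool) (L : List W) (x : W → Bool) :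
    eqOn c L x = true ↔ ∀ w ∈ L, x w = c w := by
  induction L <;> simp_all [eqOn]

theorem gtOn_of_eqOn {c : W → Bool} {L : List W} {x : W → Bool} (h : eqOn c L x = true) :
    gtOn c L x = false := by
  induction L <;> simp_all [eqOn, gtOn]

theorem eqOn_append (c : W → Bool) (L M : List W) (x : W → Bool) :
    eqOn c (L ++ M) x = (eqOn c L x && eqOn c M x) := by
  induction L with
  | nil => simp [eqOn]
  | cons w L ih => by_cases h : x w = c w <;> simp [eqOn, h, ih]

/-- The two cases exclude each other, so `xor` can replace "or"; circuits add results in exactly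
this form. -/
theorem gtOn_append (c : W → Bool) (L M : List W) (x : W → Bool) :
    gtOn c (L ++ M) x = xor (gtOn c L x) (eqOn c L x && gtOn c M x) := by
  induction L with
  | nil => simp [eqOn, gtOn]
  | cons w L ih => by_cases h : x w = c w <;> simp [eqOn, gtOn, h, ih]

theorem eqOn_congr (c : W → Bool) {L : List W} {x y : W → Bool} (h : ∀ w ∈ L, x w = y w) :
    eqOn c L x = eqOn c L y := by
  induction L <;> simp_all [eqOn]

theorem gtOn_congr (c : W → Bool) {L : List W} {x y : W → Bool} (h : ∀ w ∈ L, x w = y w) :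
    gtOn c L x = gtOn c L y := by
  induction L <;> simp_all [gtOn]

variable [DecidableEq W]

/-- Comparison of at most six wires with a constant, by a circuit of constant size. -/
theorem exists_compare_circuit_of_length_le_six (c : W → Bool) (L : List W) (F P : W)
    (hL : (F :: P :: L).Nodup) (h6 : L.length ≤ 6) :
    ∃ C : Circuit W, SupportedOn C (F :: P :: L) ∧ C.length ≤ 3000 ∧
      ∀ x, act C x = Function.update (Function.update x F (xor (x F) (gtOn c L x))) P
        (xor (x P) (eqOn c L x)) := by
  have hL' : (P :: F :: L).Nodup := (List.Perm.swap P F L).nodup_iff.1 hL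
  obtain ⟨C, hs, hl, ha⟩ := exists_xor_circuit L F P hL (gtOn c L) fun _ _ => gtOn_congr c
  obtain ⟨D, hs', hl', ha'⟩ := exists_xor_circuit L P F hL' (eqOn c L) fun _ _ => eqOn_congr c
  have h3 : 3 ^ L.length ≤ 3 ^ 6 := Nat.pow_le_pow_right (by norm_num) h6
  norm_num at h3
  refine ⟨C ++ D, hs.append (hs'.mono (List.Perm.swap F P L).subset), ?_, fun x => ?_⟩
  · rw [List.length_append]
    omega
  · simp only [List.nodup_cons, List.mem_cons, not_or] at hL
    rw [act_append, ha, ha', Function.update_of_ne (Ne.symm hL.1.1), eqOn_congr c (y := x)]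
    exact fun w hw => Function.update_of_ne (by rintro rfl; exact hL.1.2 hw) _ _

set_option maxHeartbeats 1000000 in
/-- Comparison of a register `L` with a constant in logarithmic depth and linear size. The two
results are added to the wires `F` and `P`, provided that the content of the wire `R` is known. -/
theorem exists_compare_circuit (c : W → Bool) (k : ℕ) (L : List W) (F P R : W)
    (hL : (F :: P :: R :: L).Nodup) (hk : L.length ≤ 2 ^ k) :
    ∃ C : Circuit W, DepthLE C (F :: P :: R :: L) (5000 * (k + 1)) ∧
      C.length ≤ 5000 * (L.length + 1) ∧
      ∀ x, x R = c R →
        act C x F = xor (x F) (gtOn c L x) ∧ act C x P = xor (x P) (eqOn c L x) := by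
  have base (k : ℕ) (L : List W) (F P R : W) (hL : (F :: P :: R :: L).Nodup)
      (h6 : L.length ≤ 6) : ∃ C : Circuit W, DepthLE C (F :: P :: R :: L) (5000 * (k + 1)) ∧
      C.length ≤ 5000 * (L.length + 1) ∧ ∀ x, x R = c R →
        act C x F = xor (x F) (gtOn c L x) ∧ act C x P = xor (x P) (eqOn c L x) := by
    obtain ⟨C, hs, hl, ha⟩ := exists_compare_circuit_of_length_le_six c L F P
      (hL.sublist (by simp)) h6
    refine ⟨C, .of_length_le (hs.mono ?_) (by omega), by omega, fun x _ => ?_⟩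
    · intro v; simp; tauto
    · simp only [List.nodup_cons, List.mem_cons, not_or] at hL
      simp [ha, hL.1.1]
  induction k generalizing L F P R with
  | zero => exact base 0 L F P R hL (hk.trans (by norm_num))
  | succ k ih =>
    match L, hL, hk with
    | F₁ :: P₁ :: R₁ :: F₂ :: P₂ :: R₂ :: M, hL, hk =>
      obtain ⟨L₁, L₂, rfl, hk₁, hk₂⟩ : ∃ L₁ L₂ : List W, M = L₁ ++ L₂ ∧ L₁.length ≤ 2 ^ k ∧
          L₂.length ≤ 2 ^ k := by
        refine ⟨M.take (2 ^ k), M.drop (2 ^ k), (List.take_append_drop _ _).symm, ?_, ?_⟩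
        · simp
        · simp only [List.length_cons, pow_succ] at hk
          simp only [List.length_drop]
          omega
      have hFP : F ≠ P := by rintro rfl; simp at hL
      have hFR : F ≠ R := by rintro rfl; simp at hL
      have hPR : P ≠ R := by rintro rfl; simp at hL
      have hF₁ : F ≠ P₁ ∧ F ≠ P₂ := ⟨by rintro rfl; simp at hL, by rintro rfl; simp at hL⟩
      set T : List W := [F₁, P₁, R₁, F₂, P₂, R₂] with hT
      set S₁ : List W := F₁ :: P₁ :: R₁ :: L₁ with hS₁
      set S₂ : List W := F₂ :: P₂ :: R₂ :: L₂ with hS₂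
      have hperm : (F :: P :: R :: F₁ :: P₁ :: R₁ :: F₂ :: P₂ :: R₂ :: (L₁ ++ L₂)).Perm
          ([F, P, R] ++ (S₁ ++ S₂)) := by
        refine .cons _ (.cons _ (.cons _ (.cons _ (.cons _ (.cons _ ?_)))))
        change ([F₂, P₂, R₂] ++ (L₁ ++ L₂)).Perm (L₁ ++ ([F₂, P₂, R₂] ++ L₂))
        rw [← List.append_assoc, ← List.append_assoc]
        exact List.perm_append_comm.append_right _
      have hn := hperm.nodup_iff.1 hL
      rw [List.nodup_append', List.nodup_append'] at hn
      obtain ⟨hn₀, ⟨hn₁, hn₂, h₁₂⟩, h₀⟩ := hn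
      -- Since `R` starts as `c R`, after `D` it differs from `c R` exactly when the six leading
      -- wires agree with `c`: it becomes the flag.
      obtain ⟨D, hsD, hlD, haD⟩ := exists_compare_circuit_of_length_le_six c T F R
        (hL.sublist (by simp [T])) (by simp [T])
      obtain ⟨N₁, hd₁, hl₁, ha₁⟩ := ih L₁ F₁ P₁ R₁ hn₁ hk₁
      obtain ⟨N₂, hd₂, hl₂, ha₂⟩ := ih L₂ F₂ P₂ R₂ hn₂ hk₂
      -- Each borrowed wire holds its known content plus a result; adding `c` back extracts the
      -- result. The flag multiplies everything.
      obtain ⟨E₁, hsE₁, hlE₁, haE₁⟩ := exists_xor_circuit [R, F₁, P₁, F₂] F P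
        (hL.sublist (by simp))
        (fun x => xor (x R) (c R) && (xor (xor (x F₁) (c F₁))
          (xor (x P₁) (c P₁) && xor (x F₂) (c F₂)))) (by intro x y h; simp_all)
      obtain ⟨E₂, hsE₂, hlE₂, haE₂⟩ := exists_xor_circuit [R, P₁, P₂] P F
        ((List.Perm.swap P F _).nodup_iff.1 (hL.sublist (by simp)))
        (fun x => xor (x R) (c R) && (xor (x P₁) (c P₁) && xor (x P₂) (c P₂)))
        (by intro x y h; simp_all)
      refine ⟨D ++ ((N₁ ++ N₂) ++ (E₁ ++ E₂)), ?_, ?_, fun x hR => ?_⟩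
      · have hD : DepthLE D _ 3000 := .of_length_le (hsD.mono
          (S' := F :: P :: R :: F₁ :: P₁ :: R₁ :: F₂ :: P₂ :: R₂ :: (L₁ ++ L₂))
          (by intro v; simp [T]; tauto)) hlD
        have hN := (hd₁.parallel hd₂ h₁₂).mono (e := 5000 * (k + 1))
          (fun v hv => hperm.symm.subset (List.mem_append_right _ hv)) le_rfl
        have hE : DepthLE (E₁ ++ E₂) _ 1000 := .of_length_le ((hsE₁.mono
          (S' := F :: P :: R :: F₁ :: P₁ :: R₁ :: F₂ :: P₂ :: R₂ :: (L₁ ++ L₂))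
          (by intro v; simp; tauto)).append (hsE₂.mono (by intro v; simp; tauto)))
          (by simp only [List.length_append]; norm_num at hlE₁ hlE₂; omega)
        exact (hD.append (hN.append hE)).mono (List.Subset.refl _) (by omega)
      -- The six wires used up here leave a surplus of `5 * 5000` over the budgets of the two
      -- halves, which pays for `D`, `E₁` and `E₂`.
      · simp only [List.length_append, List.length_cons]
        norm_num at hlE₁ hlE₂
        omega
      · have e₁ : ∀ w, w ∉ S₁ → ∀ y, act N₁ y w = y w := fun w hw y => hd₁.supp.act_of_notMem y hw
        have e₂ : ∀ w, w ∉ S₂ → ∀ y, act N₂ y w = y w := fun w hw y => hd₂.supp.act_of_notMem y hw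
        have d₁ : ∀ w ∈ S₁, w ∉ S₂ := fun w h h' => h₁₂ h h'
        have d₂ : ∀ w ∈ S₂, w ∉ S₁ := fun w h h' => h₁₂ h' h
        have d₀ : ∀ w ∈ [F, P, R], w ∉ S₁ ∧ w ∉ S₂ := fun w h =>
          ⟨fun h' => h₀ h (List.mem_append_left _ h'), fun h' => h₀ h (List.mem_append_right _ h')⟩
        set y := act D x with hy
        have hyF : y F = xor (x F) (gtOn c T x) := by simp [hy, haD, hFR]
        have hyR : y R = xor (x R) (eqOn c T x) := by simp [hy, haD]
        have hyw : ∀ w, w ≠ F → w ≠ R → y w = x w := fun w h h' => by simp [hy, haD, h, h']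
        have hyP : y P = x P := hyw P hFP.symm hPR
        have hy₁ : ∀ w ∈ S₁, y w = x w := fun w hw => hyw w
          (by rintro rfl; exact (d₀ w (by simp)).1 hw) (by rintro rfl; exact (d₀ w (by simp)).1 hw)
        have hy₂ : ∀ w ∈ S₂, y w = x w := fun w hw => hyw w
          (by rintro rfl; exact (d₀ w (by simp)).2 hw) (by rintro rfl; exact (d₀ w (by simp)).2 hw)
        have hz₂ : ∀ w ∈ S₂, act N₁ y w = x w := fun w hw => (e₁ w (d₂ w hw) y).trans (hy₂ w hw)
        set z := act N₂ (act N₁ y) with hz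
        have hz₀ : ∀ w ∈ [F, P, R], z w = y w := fun w hw => by
          rw [hz, e₂ w (d₀ w hw).2, e₁ w (d₀ w hw).1]
        have hz₁ : ∀ w ∈ S₁, z w = act N₁ y w := fun w hw => by rw [hz, e₂ w (d₁ w hw)]
        have hres : act (D ++ ((N₁ ++ N₂) ++ (E₁ ++ E₂))) x = act E₂ (act E₁ z) := by
          simp [hz, hy]
        have hsplit : F₁ :: P₁ :: R₁ :: F₂ :: P₂ :: R₂ :: (L₁ ++ L₂) = T ++ (L₁ ++ L₂) := rfl
        have hzF := hz₀ F (by simp)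
        have hzP := hz₀ P (by simp)
        have hzR := hz₀ R (by simp)
        rw [hres, hsplit, gtOn_append, gtOn_append, eqOn_append, eqOn_append, haE₂, haE₁]
        simp only [Function.update_self, Function.update_of_ne hFP, Function.update_of_ne hFP.symm,
          Function.update_of_ne hFR.symm, Function.update_of_ne hF₁.1.symm,
          Function.update_of_ne hF₁.2.symm, hzF, hzP, hzR, hyF, hyR, hyP, hR]
        -- If the flag is off, `N₁` and `N₂` may have produced garbage, but it is masked. If it is
        -- on, the borrowed wires have the contents that the induction hypothesis needs.
        cases hT' : eqOn c T x with
        | false => simp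
        | true =>
          have hTx := (eqOn_iff c T x).1 hT'
          obtain ⟨a₁, b₁⟩ := ha₁ y (by rw [hy₁ R₁ (by simp [S₁]), hTx R₁ (by simp [T])])
          obtain ⟨a₂, b₂⟩ := ha₂ (act N₁ y) (by rw [hz₂ R₂ (by simp [S₂]), hTx R₂ (by simp [T])])
          rw [hy₁ F₁ (by simp [S₁]), hTx F₁ (by simp [T]),
            gtOn_congr c (fun w hw => hy₁ w (by simp [S₁, hw]))] at a₁
          rw [hy₁ P₁ (by simp [S₁]), hTx P₁ (by simp [T]),
            eqOn_congr c (fun w hw => hy₁ w (by simp [S₁, hw]))] at b₁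
          rw [hz₂ F₂ (by simp [S₂]), hTx F₂ (by simp [T]),
            gtOn_congr c (fun w hw => hz₂ w (by simp [S₂, hw]))] at a₂
          rw [hz₂ P₂ (by simp [S₂]), hTx P₂ (by simp [T]),
            eqOn_congr c (fun w hw => hz₂ w (by simp [S₂, hw]))] at b₂
          rw [hz₁ F₁ (by simp [S₁]), hz₁ P₁ (by simp [S₁]), a₁, b₁, hz, a₂, b₂]
          generalize gtOn c L₁ x = g₁
          generalize gtOn c L₂ x = g₂
          generalize eqOn c L₁ x = q₁
          generalize eqOn c L₂ x = q₂
          generalize c R = r₀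
          generalize c F₁ = r₁
          generalize c P₁ = r₂
          generalize c F₂ = r₃
          generalize c P₂ = r₄
          constructor
          · have hxor : ∀ a b : Bool, xor (xor a b) a = b := by decide
            simp [hxor]
          · have hxor : ∀ a b : Bool, xor (xor a b) a = b := by decide
            simp [hxor]
    | [], hL, hk | [_], hL, hk | [_, _], hL, hk | [_, _, _], hL, hk | [_, _, _, _], hL, hk
    | [_, _, _, _, _], hL, hk => exact base _ _ F P R hL (by simp)

end Circuit

end QCircuit

/-! ### The full comparator: uncomputation and one dirty wire. -/

namespace QCircuit

namespace Circuit

variable {W : Type} [DecidableEq W]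

/-- Adding the result of the comparison of the register `L` with a constant to the wire `z`, in
logarithmic depth and linear size, using one dirty wire `d`. -/
theorem exists_comparator_circuit (c : W → Bool) (k : ℕ) (L : List W) (z d : W)
    (hL : (z :: d :: L).Nodup) (hk : L.length ≤ 2 ^ k) :
    ∃ C : Circuit W, DepthLE C (z :: d :: L) (30000 * (k + 1)) ∧
      C.length ≤ 30000 * (L.length + 1) ∧
      ∀ x, act C x = Function.update x z (xor (x z) (gtOn c L x)) := by
  have base (L : List W) (hL : (z :: d :: L).Nodup) (h6 : L.length ≤ 6) :
      ∃ C : Circuit W, DepthLE C (z :: d :: L) (30000 * (k + 1)) ∧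
      C.length ≤ 30000 * (L.length + 1) ∧
      ∀ x, act C x = Function.update x z (xor (x z) (gtOn c L x)) := by
    obtain ⟨C, hs, hl, ha⟩ := exists_xor_circuit L z d hL (gtOn c L) fun _ _ => gtOn_congr c
    have h3 : 3 ^ L.length ≤ 3 ^ 6 := Nat.pow_le_pow_right (by norm_num) h6
    norm_num at h3
    exact ⟨C, .of_length_le hs (by omega), by omega, ha⟩
  match L, hL, hk with
  | F :: P :: R :: M, hL, hk =>
    simp only [List.length_cons] at hk
    have hzd : z ≠ d := by rintro rfl; simp at hL
    have hdz := hzd.symm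
    have hzF : z ≠ F := by rintro rfl; simp at hL
    have hdF : d ≠ F := by rintro rfl; simp at hL
    have hzL : z ∉ F :: P :: R :: M := fun h => by simp_all
    have hdL : d ∉ F :: P :: R :: M := fun h => by simp_all
    obtain ⟨N, hdN, hlN, haN⟩ := exists_compare_circuit c k M F P R (hL.sublist (by simp))
      (by omega)
    have hsub : F :: P :: R :: M ⊆ z :: d :: F :: P :: R :: M := by intro v; simp; tauto
    have hdN' := hdN.mono hsub le_rfl
    have hG : SupportedOn [Gate.CCX d F z hdF hdz hzF.symm] (z :: d :: F :: P :: R :: M) := by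
      simp [SupportedOn, Gate.wires]
    -- The summand with `c F` compensates for the initial content of `F`, which `N` leaves added to
    -- its result.
    obtain ⟨A, hsA, hlA, haA⟩ := exists_xor_circuit [F, P, R] z d (hL.sublist (by simp))
      (fun x => xor (gtOn c [F, P, R] x) (eqOn c [F, P, R] x && c F))
      fun _ _ h => by rw [gtOn_congr c h, eqOn_congr c h]
    obtain ⟨B, hsB, hlB, haB⟩ := exists_xor_circuit [F, P, R] d z
      ((List.Perm.swap d z _).nodup_iff.1 (hL.sublist (by simp)))
      (eqOn c [F, P, R]) fun _ _ => eqOn_congr c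
    norm_num at hlA hlB
    have hsA' := hsA.mono (S' := z :: d :: F :: P :: R :: M) (by intro v; simp; tauto)
    have hsB' := hsB.mono (S' := z :: d :: F :: P :: R :: M) (by intro v; simp; tauto)
    -- Compute, copy under control of `d`, uncompute: reversal restores the register because the
    -- gates are involutions.
    set U : Circuit W := N ++ ([Gate.CCX d F z hdF hdz hzF.symm] ++ N.reverse) with hU
    have hUd : DepthLE U (z :: d :: F :: P :: R :: M) (5000 * (k + 1) + (1 + 5000 * (k + 1))) :=
      hdN'.append ((DepthLE.of_length_le hG le_rfl).append hdN'.reverse)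
    have hUl : U.length = N.length + (1 + N.length) := by simp [hU, add_comm]
    have hUa : ∀ x, act U x = Function.update x z (xor (x z) (x d && act N x F)) := by
      intro x
      simp only [hU, act_append, act_cons, act_nil, Gate.act]
      rw [hdN.supp.reverse.act_update _ hzL, act_reverse_act, hdN.supp.act_of_notMem x hzL,
        hdN.supp.act_of_notMem x hdL]
    -- `B` toggles `d` by the equality flag of the three leading wires, so the two copies of `U`
    -- together add flag times result, whatever `d` holds; the last `B` restores `d`.
    refine ⟨A ++ (U ++ (B ++ (U ++ B))), ?_, ?_, fun x => ?_⟩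
    · exact ((DepthLE.of_length_le hsA' (d := 200) (by omega)).append (hUd.append
        ((DepthLE.of_length_le hsB' (d := 200) (by omega)).append (hUd.append
        (DepthLE.of_length_le hsB' (d := 200) (by omega)))))).mono (List.Subset.refl _) (by omega)
    · simp only [List.length_append, List.length_cons]
      omega
    · have hNz : ∀ (y : W → Bool) b, act N (Function.update y z b) F = act N y F := fun y b => by
        rw [hdN.supp.act_update y hzL, Function.update_of_ne hzF.symm]
      have hNd : ∀ (y : W → Bool) b, act N (Function.update y d b) F = act N y F := fun y b => by
        rw [hdN.supp.act_update y hdL, Function.update_of_ne hdF.symm]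
      have hTL : ∀ w ∈ [F, P, R], w ∈ F :: P :: R :: M := by intro v; simp; tauto
      have hez : ∀ (y : W → Bool) b, eqOn c [F, P, R] (Function.update y z b) =
          eqOn c [F, P, R] y := fun y b => eqOn_congr c fun w hw =>
        Function.update_of_ne (by rintro rfl; exact hzL (hTL _ hw)) _ _
      have hed : ∀ (y : W → Bool) b, eqOn c [F, P, R] (Function.update y d b) =
          eqOn c [F, P, R] y := fun y b => eqOn_congr c fun w hw =>
        Function.update_of_ne (by rintro rfl; exact hdL (hTL _ hw)) _ _
      have hsplit : F :: P :: R :: M = [F, P, R] ++ M := rfl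
      simp only [act_append, haA, haB, hUa, hNz, hNd, hez, hed, Function.update_self,
        Function.update_of_ne hzd, Function.update_of_ne hdz]
      rw [hsplit, gtOn_append]
      funext v
      by_cases hv : v = z
      · subst hv
        simp only [Function.update_self, Function.update_of_ne hzd]
        cases hT : eqOn c [F, P, R] x with
        | false => cases x v <;> cases gtOn c [F, P, R] x <;> cases x d <;> cases act N x F <;> rfl
        | true =>
          have hTx := (eqOn_iff c _ x).1 hT
          rw [(haN x (hTx R (by simp))).1, hTx F (by simp), gtOn_of_eqOn hT]
          cases x v <;> cases x d <;> cases gtOn c M x <;> cases c F <;> rfl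
      · by_cases hv' : v = d
        · subst hv'
          simp [hv]
        · simp [hv, hv']
  | [], hL, hk | [_], hL, hk | [_, _], hL, hk => exact base _ hL (by simp)

/-! ### Padding by cancelling `X` gates, which forces the lower bounds for the constructed circuit
even if `c` is easy. -/

/-- Each wire of `L` is flipped twice. -/
def flips (L : List W) : Circuit W := L.flatMap fun w => [.X w, .X w]

theorem act_flips (L : List W) (x : W → Bool) : act (flips L) x = x := by
  induction L generalizing x with
  | nil => rfl
  | cons w L ih =>
    have h := (Gate.X w).act_act x
    simp only [flips, List.flatMap_cons, act_append, act_cons, act_nil, h]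
    exact ih x

omit [DecidableEq W] in
theorem length_flips (L : List W) : (flips L).length = 2 * L.length := by
  simp [flips, mul_comm]

theorem depthLE_flips (L : List W) (hL : L.Nodup) : DepthLE (flips L) L 2 := by
  induction L with
  | nil => exact .of_length_le (by simp [flips, SupportedOn]) (by simp [flips])
  | cons w L ih =>
    rw [List.nodup_cons] at hL
    exact (DepthLE.of_length_le (S := [w]) (C := [.X w, .X w]) (by simp [SupportedOn, Gate.wires])
      le_rfl).parallel (ih hL.2) (by simpa using hL.1)

theorem schedule_le (b : W → ℕ) (g : Gate W) (w : W) : b w ≤ schedule b g w := by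
  unfold schedule
  split_ifs with h
  · exact (Finset.le_sup h).trans (Nat.le_succ _)
  · exact le_rfl

theorem le_foldl_schedule (C : Circuit W) (b : W → ℕ) (w : W) : b w ≤ C.foldl schedule b w := by
  induction C generalizing b with
  | nil => exact le_rfl
  | cons g C ih => exact (schedule_le b g w).trans (ih _)

theorem le_depth_replicate_append [Fintype W] (C : Circuit W) (w : W) (k : ℕ) :
    k ≤ depth (List.replicate k (Gate.X w) ++ C) := by
  refine le_trans ?_ (Finset.le_sup (Finset.mem_univ w))
  rw [List.foldl_append]
  refine le_trans ?_ (le_foldl_schedule C _ w)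
  have (b : W → ℕ) : (List.replicate k (Gate.X w)).foldl schedule b w = b w + k := by
    induction k generalizing b with
    | zero => rfl
    | succ k ih => rw [List.replicate_succ, List.foldl_cons, ih]; simp [schedule, Gate.wires]; omega
  simp [this]

theorem act_replicate_two_mul (w : W) (k : ℕ) (x : W → Bool) :
    act (List.replicate (2 * k) (Gate.X w)) x = x := by
  induction k with
  | zero => rfl
  | succ k ih =>
    rw [mul_add, mul_one, List.replicate_succ, List.replicate_succ, act_cons, act_cons,
      Gate.act_act, ih]

/-- The comparator circuit with a number of gates and a depth of the exact orders. -/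
theorem exists_comparator_circuit_exact_order [Fintype W] (c : W → Bool) (k : ℕ) (L : List W)
    (z d : W) (hL : (z :: d :: L).Nodup) (hk : L.length ≤ 2 ^ k) :
    ∃ C : Circuit W, depth C ≤ 30100 * (k + 1) ∧ k ≤ depth C ∧ L.length ≤ C.length ∧
      C.length ≤ 30100 * (L.length + 1) + 2 * k ∧
      ∀ x, act C x = Function.update x z (xor (x z) (gtOn c L x)) := by
  obtain ⟨C, hd, hl, ha⟩ := exists_comparator_circuit c k L z d hL hk
  -- Flips of the single wire `z` are sequential and force depth; the flips of `L` force size at the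
  -- cost of two time steps.
  refine ⟨List.replicate (2 * k) (.X z) ++ (flips L ++ C), ?_, ?_, ?_, ?_, fun x => ?_⟩
  · have h1 : DepthLE (List.replicate (2 * k) (Gate.X z)) (z :: d :: L) (2 * k) :=
      .of_length_le (fun g hg => by simp [List.eq_of_mem_replicate hg, Gate.wires]) (by simp)
    have h2 := (depthLE_flips L (hL.sublist (by simp))).mono (S' := z :: d :: L)
      (by intro v; simp; tauto) le_rfl
    exact (h1.append (h2.append hd)).fwd.depth_le.trans (by omega)
  · exact le_trans (by omega) (le_depth_replicate_append _ z (2 * k))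
  · simp only [List.length_append, length_flips]; omega
  · simp only [List.length_append, length_flips, List.length_replicate]; omega
  · rw [act_append, act_append, act_replicate_two_mul, act_flips, ha]

end Circuit

end QCircuit

/-! ### From maps of basis labels to operators on states. -/

namespace QCircuit

theorem opOfMap_mul {W : Type} [Fintype W] [DecidableEq W] (f g : (W → Bool) → W → Bool) :
    opOfMap g * opOfMap f = opOfMap (g ∘ f) := by
  ext y x
  simp [opOfMap, Matrix.mul_apply]

theorem opOfMap_mulVec_ket {W : Type} [Fintype W] [DecidableEq W] (f : (W → Bool) → W → Bool)
    (x : W → Bool) : (opOfMap f).mulVec (ket x) = ket (f x) := by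
  ext y
  simp [opOfMap, ket, Pi.single_apply]

theorem tensor_ket_ket {W A : Type} [Fintype W] [DecidableEq W] [Fintype A] [DecidableEq A]
    (x : W → Bool) (y : A → Bool) : tensor (ket x) (ket y) = ket (Sum.elim x y) := by
  ext s
  have : s = Sum.elim x y ↔ (fun w => s (Sum.inl w)) = x ∧ (fun a => s (Sum.inr a)) = y := by
    constructor
    · rintro rfl; exact ⟨rfl, rfl⟩
    · rintro ⟨rfl, rfl⟩; exact (Sum.elim_comp_inl_inr s).symm
  simp only [tensor, ket, Pi.single_apply, this]
  split_ifs <;> simp_all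

theorem ket_injective {W : Type} [Fintype W] [DecidableEq W] {x y : W → Bool}
    (h : ket x = ket y) : x = y := by
  by_contra hne
  have := congrFun h x
  simp [ket, hne] at this

/-- As `f` fixes the ancilla label, only one ancilla term survives in each output amplitude.
Restoring the ancilla on basis labels therefore suffices for arbitrary ancilla states. -/
theorem opOfMap_mulVec_tensor {W A : Type} [Fintype W] [DecidableEq W] [Fintype A] [DecidableEq A]
    (f : (W ⊕ A → Bool) → W ⊕ A → Bool) (g : (W → Bool) → W → Bool)
    (h : ∀ x y, f (Sum.elim x y) = Sum.elim (g x) y) (ψ : State W) (φ : State A) :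
    (opOfMap f).mulVec (tensor ψ φ) = tensor ((opOfMap g).mulVec ψ) φ := by
  ext s
  have hs : ∀ u v, s = Sum.elim (g u) v ↔ (fun w => s (Sum.inl w)) = g u ∧
      (fun a => s (Sum.inr a)) = v := by
    refine fun u v => ⟨?_, ?_⟩
    · rintro h; rw [h]; exact ⟨rfl, rfl⟩
    · rintro ⟨h, rfl⟩; rw [← h]; exact (Sum.elim_comp_inl_inr s).symm
  simp only [tensor, Matrix.mulVec, dotProduct, opOfMap, Matrix.of_apply, Finset.sum_mul]
  rw [← (Equiv.sumArrowEquivProdArrow W A Bool).symm.sum_comp, Fintype.sum_prod_type]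
  refine Finset.sum_congr rfl fun u _ => ?_
  have hf : ∀ v, f ((Equiv.sumArrowEquivProdArrow W A Bool).symm (u, v)) = Sum.elim (g u) v :=
    fun v => h u v
  simp only [hf, hs]
  rw [Finset.sum_eq_single fun a => s (Sum.inr a)]
  · simp
  · intro v _ hv
    simp [Ne.symm hv]
  · simp

namespace Circuit

variable {W : Type} [DecidableEq W]

theorem op_eq_opOfMap_act [Fintype W] (C : Circuit W) : op C = opOfMap (act C) := by
  induction C with
  | nil =>
    ext y x
    simp [op, opOfMap, Matrix.one_apply]
    congr
  | cons g C ih =>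
    rw [op, ih, Gate.op, opOfMap_mul]
    rfl

/-! ### Lower bounds from light cones. -/

/-- The value of the wire `w` after the circuit is determined by the initial values of at most
`3 ^ t` wires, where `t` is the time when `w` was last busy; they are `w` itself and wires that
the circuit acts on. -/
theorem exists_dependency_sets (C : Circuit W) :
    ∃ U : Finset W, U.card ≤ 3 * C.length ∧ ∀ w, ∃ D ⊆ insert w U,
      D.card ≤ 3 ^ (C.foldl schedule (fun _ => 0) w) ∧
      ∀ x y : W → Bool, (∀ v ∈ D, x v = y v) → act C x w = act C y w := by
  induction C using List.reverseRecOn with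
  | nil => exact ⟨∅, by simp, fun w => ⟨{w}, by simp, by simp, fun x y h => h w (by simp)⟩⟩
  | append_singleton C g ih =>
    obtain ⟨U, hU, hw⟩ := ih
    choose D hDU hDc hD using hw
    refine ⟨g.wires ∪ U, ?_, fun w => ?_⟩
    · have := (Finset.card_union_le g.wires U).trans (add_le_add g.card_wires_le hU)
      simp only [List.length_append, List.length_cons, List.length_nil]
      omega
    · simp only [List.foldl_append, List.foldl_cons, List.foldl_nil, act_append, act_cons, act_nil]
      by_cases hg : w ∈ g.wires
      -- The light cone of an output of `g` is the union of at most three earlier ones, each bounded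
      -- through the latest busy time among the wires of `g`.
      · refine ⟨g.wires.biUnion D, ?_, ?_, fun x y h => ?_⟩
        · refine Finset.biUnion_subset.2 fun v hv u hu => ?_
          have := hDU v hu
          simp only [Finset.mem_insert, Finset.mem_union] at this ⊢
          rcases this with rfl | h
          exacts [.inr (.inl hv), .inr (.inr h)]
        · rw [schedule, if_pos hg, pow_succ, mul_comm]
          refine (Finset.card_biUnion_le_card_mul _ _ _ fun v hv => (hDc v).trans ?_).trans
            (Nat.mul_le_mul_right _ g.card_wires_le)
          exact Nat.pow_le_pow_right (by norm_num) (Finset.le_sup hv)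
        · exact g.act_congr (fun v hv => hD v x y fun u hu =>
            h u (Finset.mem_biUnion.2 ⟨v, hv, hu⟩)) w hg
      · refine ⟨D w, (hDU w).trans (Finset.insert_subset_insert _ Finset.subset_union_right), ?_,
          fun x y h => ?_⟩
        · rw [schedule, if_neg hg]
          exact hDc w
        · rw [g.act_of_notMem _ hg, g.act_of_notMem _ hg]
          exact hD w x y h

/-- A circuit in which the final value of the wire `w` depends on the initial values of all wires
in `S` has depth logarithmic and size linear in the cardinality of `S`. -/
theorem card_le_of_depends [Fintype W] (C : Circuit W) (w : W) (S : Finset W) (hw : w ∉ S)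
    (hS : ∀ v ∈ S, ∃ x b, act C (Function.update x v b) w ≠ act C x w) :
    S.card ≤ 3 * gateCount C ∧ S.card ≤ 3 ^ depth C := by
  obtain ⟨U, hU, h⟩ := exists_dependency_sets C
  obtain ⟨D, hDU, hDc, hD⟩ := h w
  have hSD : S ⊆ D := fun v hv => by
    by_contra hvD
    obtain ⟨x, b, hxb⟩ := hS v hv
    exact hxb (hD _ _ fun u hu => Function.update_of_ne (by rintro rfl; exact hvD hu) _ _)
  have hSU : S ⊆ U := fun v hv => (Finset.mem_insert.1 (hDU (hSD hv))).resolve_left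
    (by rintro rfl; exact hw hv)
  exact ⟨(Finset.card_le_card hSU).trans hU, (Finset.card_le_card hSD).trans (hDc.trans
    (Nat.pow_le_pow_right (by norm_num) (Finset.le_sup (Finset.mem_univ w))))⟩

omit [DecidableEq W] in
theorem gtOn_map {V : Type} (f : V → W) (c : W → Bool) (L : List V) (x : W → Bool) :
    gtOn c (L.map f) x = gtOn (c ∘ f) L (x ∘ f) := by
  induction L <;> simp_all [gtOn]

omit [DecidableEq W] in
theorem gtOn_eq_false {c : W → Bool} {L : List W} (h : ∀ w ∈ L, c w = true) (x : W → Bool) :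
    gtOn c L x = false := by
  induction L <;> simp_all [gtOn]

omit [DecidableEq W] in
theorem eqOn_map {V : Type} (f : V → W) (c : W → Bool) (L : List V) (x : W → Bool) :
    eqOn c (L.map f) x = eqOn (c ∘ f) L (x ∘ f) := by
  induction L <;> simp_all [eqOn]

end Circuit

/-! ### Binary numbers, and both bounds for the comparator. -/

/-- Induction removes the least significant bit, the last in the reversed list. It matters only if
the higher bits agree, so equality is carried along. -/
theorem decide_ofBits_lt_and_eq {n : ℕ} (c a : Fin n → Bool) :
    decide (Nat.ofBits c < Nat.ofBits a) = Circuit.gtOn c (List.finRange n).reverse a ∧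
    decide (Nat.ofBits a = Nat.ofBits c) = Circuit.eqOn c (List.finRange n).reverse a := by
  induction n with
  | zero => simp [Circuit.gtOn, Circuit.eqOn]
  | succ n ih =>
    obtain ⟨h₁, h₂⟩ := ih (c ∘ Fin.succ) (a ∘ Fin.succ)
    rw [List.finRange_succ, List.reverse_cons, ← List.map_reverse, Circuit.gtOn_append,
      Circuit.eqOn_append, Circuit.gtOn_map, Circuit.eqOn_map, ← h₁, ← h₂, Nat.ofBits_succ c,
      Nat.ofBits_succ a]
    generalize Nat.ofBits (c ∘ Fin.succ) = p
    generalize Nat.ofBits (a ∘ Fin.succ) = q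
    rcases lt_trichotomy p q with h | h | h
    · cases h₀ : c 0 <;> cases h₀' : a 0 <;> 
        simp [Circuit.gtOn, Circuit.eqOn, h.ne', h, h₀, h₀'] <;> omega
    · cases h₀ : c 0 <;> cases h₀' : a 0 <;> simp [Circuit.gtOn, Circuit.eqOn, *]
    · cases h₀ : c 0 <;> cases h₀' : a 0 <;> 
        simp [Circuit.gtOn, Circuit.eqOn, h.not_gt, h.ne, h, h₀, h₀'] <;> omega

theorem exists_implementsWithDirty_cqComparator (n k : ℕ) (hk : n ≤ 2 ^ k) (c : Fin n → Bool) :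
    ∃ C : Circuit (CmpWires n ⊕ Fin 1), ImplementsWithDirty C (cqComparator n c) ∧
      n ≤ C.gateCount ∧ C.gateCount ≤ 30100 * (n + 1) + 2 * k ∧
      k ≤ C.depth ∧ C.depth ≤ 30100 * (k + 1) := by
  let f : Fin n → CmpWires n ⊕ Fin 1 := fun i => Sum.inl (Sum.inl i)
  have hf : Function.Injective f := fun i j h => by simpa [f] using h
  obtain ⟨C, hd, hd', hl, hl', ha⟩ := Circuit.exists_comparator_circuit_exact_order
    (Sum.elim (Sum.elim c fun _ => false) fun _ => false) k ((List.finRange n).reverse.map f)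
    (Sum.inl (Sum.inr ())) (Sum.inr 0)
    (by simp [f, List.nodup_map_iff hf, List.nodup_finRange]) (by simpa using hk)
  simp only [List.length_map, List.length_reverse, List.length_finRange] at hl hl'
  refine ⟨C, fun ψ φ => ?_, hl, hl', hd', hd⟩
  rw [Circuit.op_eq_opOfMap_act, cqComparator]
  refine opOfMap_mulVec_tensor _ _ (fun x y => ?_) ψ φ
  rw [ha, Circuit.gtOn_map, (decide_ofBits_lt_and_eq _ _).1]
  funext v
  rcases v with v | v
  · by_cases hv : v = Sum.inr ()
    · subst hv
      simp [f, Function.comp_def]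
    · simp [hv]
  · simp

/-- The comparator with the constant `2 ^ n - 2` depends on all input qubits, which bounds the
number of gates and the depth from below. -/
theorem lower_bound_of_implementsWithClean {n m : ℕ} {c : Fin n → Bool}
    (hc : ∀ i, c i = decide ((i : ℕ) ≠ 0)) {C : Circuit (CmpWires n ⊕ Fin m)} (hC : ImplementsWithClean C (cqComparator n c)) :
    n ≤ 3 * C.gateCount ∧ n ≤ 3 ^ C.depth := by
  let f : Fin n → CmpWires n ⊕ Fin m := fun i => Sum.inl (Sum.inl i)
  have hf : Function.Injective f := fun i j h => by simpa [f] using h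
  have hact : ∀ s, Circuit.act C (Sum.elim s fun _ => false) (Sum.inl (Sum.inr ())) =
      xor (s (Sum.inr ())) (decide (Nat.ofBits c < Nat.ofBits fun i => s (Sum.inl i))) := by
    intro s
    have h := hC (ket s)
    rw [Circuit.op_eq_opOfMap_act, cqComparator, opOfMap_mulVec_ket, tensor_ket_ket,
      tensor_ket_ket, opOfMap_mulVec_ket] at h
    simpa using congrFun (ket_injective h) (Sum.inl (Sum.inr ()))
  -- Only the all-ones string exceeds `c`, so clearing any one of its bits changes the target. At `n
  -- = 0` the condition on bits is vacuous but `0 < 0` fails, hence `1 ≤ n`.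
  have hgt : ∀ a : Fin n → Bool, Nat.ofBits c < Nat.ofBits a ↔ 1 ≤ n ∧ ∀ i, a i = true := by
    intro a
    cases n with
    | zero => simp
    | succ n =>
      rw [← decide_eq_true_iff (p := Nat.ofBits c < Nat.ofBits a),
        (decide_ofBits_lt_and_eq c a).1, List.finRange_succ, List.reverse_cons,
        ← List.map_reverse, Circuit.gtOn_append,
        Circuit.gtOn_eq_false (by simp [hc]), Bool.false_xor, Bool.and_eq_true, Circuit.eqOn_iff]
      simp [hc, Circuit.gtOn, Fin.forall_fin_succ, and_comm]
  have h := Circuit.card_le_of_depends C (Sum.inl (Sum.inr ())) (Finset.univ.map ⟨f, hf⟩)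
    (by simp [f]) (fun v hv => ?_)
  · simpa using h
  · obtain ⟨i, -, rfl⟩ := Finset.mem_map.1 hv
    refine ⟨Sum.elim (fun w => Sum.elim (fun _ => true) (fun _ => false) w) fun _ => false,
      false, ?_⟩
    have hu : Function.update (Sum.elim (fun w => Sum.elim (fun _ => true) (fun _ => false) w)
        fun _ => false) ((⟨f, hf⟩ : Fin n ↪ _) i) false =
        Sum.elim (Function.update (Sum.elim (fun _ => true) (fun _ => false)) (Sum.inl i) false)
        (fun _ : Fin m => false) := Sum.update_elim_inl
    have hn : 1 ≤ n := Nat.one_le_of_lt i.2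
    rw [hu, hact, hact]
    simp [hgt, hn]
    exact ⟨i, by simp⟩

end QCircuit

theorem mainTheorem3 :
    ∃ k K : ℝ, 0 < k ∧ 0 < K ∧ ∀ n : ℕ, 1 ≤ n →
      (∀ c : Fin n → Bool,
        ∃ C : QCircuit.Circuit (QCircuit.CmpWires n ⊕ Fin 1),
          QCircuit.ImplementsWithDirty C (QCircuit.cqComparator n c) ∧
          k * (n : ℝ) ≤ (QCircuit.Circuit.gateCount C : ℝ) ∧
          (QCircuit.Circuit.gateCount C : ℝ) ≤ K * (n : ℝ) ∧
          (2 ≤ n →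
            k * Real.logb 2 (n : ℝ) ≤ (QCircuit.Circuit.depth C : ℝ) ∧
            (QCircuit.Circuit.depth C : ℝ) ≤ K * Real.logb 2 (n : ℝ))) ∧
      (∃ c : Fin n → Bool,
        ∀ (m : ℕ) (C : QCircuit.Circuit (QCircuit.CmpWires n ⊕ Fin m)),
          QCircuit.ImplementsWithClean C (QCircuit.cqComparator n c) →
            k * (n : ℝ) ≤ (QCircuit.Circuit.gateCount C : ℝ) ∧
            k * Real.logb 2 (n : ℝ) ≤ (QCircuit.Circuit.depth C : ℝ)) := by
  have hpow : ∀ (n e : ℕ), 1 ≤ n → n ≤ 2 ^ e → Real.logb 2 n ≤ e := by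
    intro n e hn h
    rw [Real.logb_le_iff_le_rpow (by norm_num) (by exact_mod_cast hn), Real.rpow_natCast]
    exact_mod_cast h
  -- `1 / 3` reflects three wires per gate; `100000` absorbs `30100 * (log n + 2) ≤ 90300 * log n`,
  -- valid once `log n ≥ 1`.
  refine ⟨1 / 3, 100000, by norm_num, by norm_num, fun n hn => ⟨fun c => ?_, ?_⟩⟩
  · have hk := Nat.le_pow_clog (b := 2) (by norm_num) n
    obtain ⟨C, hC, h₁, h₂, h₃, h₄⟩ :=
      QCircuit.exists_implementsWithDirty_cqComparator n (Nat.clog 2 n) hk c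
    have hlog : 0 ≤ Real.logb 2 n := Real.logb_nonneg (by norm_num) (by exact_mod_cast hn)
    have hkn : Nat.clog 2 n ≤ n := Nat.clog_le_of_le_pow Nat.lt_two_pow_self.le
    refine ⟨C, hC, ?_, ?_, fun h2 => ⟨?_, ?_⟩⟩
    · have : (n : ℝ) ≤ C.gateCount := by exact_mod_cast h₁
      linarith [(Nat.cast_nonneg n : (0 : ℝ) ≤ n)]
    · have : C.gateCount ≤ 100000 * n := by omega
      exact_mod_cast this
    · have h := hpow n _ hn hk
      have : ((Nat.clog 2 n : ℕ) : ℝ) ≤ C.depth := by exact_mod_cast h₃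
      linarith
    · have hlt : 2 ^ (Nat.clog 2 n - 1) < n := Nat.pow_pred_clog_lt_self (by norm_num) h2
      have hle : ((Nat.clog 2 n - 1 : ℕ) : ℝ) ≤ Real.logb 2 n := by
        rw [Real.le_logb_iff_rpow_le (by norm_num) (by exact_mod_cast hn), Real.rpow_natCast]
        exact_mod_cast hlt.le
      have hpos : 1 ≤ Nat.clog 2 n := Nat.clog_pos (by norm_num) h2
      have hone : 1 ≤ Real.logb 2 n := by
        rw [Real.le_logb_iff_rpow_le (by norm_num) (by exact_mod_cast hn), Real.rpow_one]
        exact_mod_cast h2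
      have h4 : (C.depth : ℝ) ≤ 30100 * (Nat.clog 2 n + 1) := by exact_mod_cast h₄
      rw [Nat.cast_sub hpos, Nat.cast_one] at hle
      linarith
  · refine ⟨fun i => decide ((i : ℕ) ≠ 0), fun m C hC => ?_⟩
    obtain ⟨h₁, h₂⟩ := QCircuit.lower_bound_of_implementsWithClean (fun _ => rfl) hC
    -- Replacing 3 by 4 gives a power of two, at the cost of a factor 2 in depth that `1 / 3`
    -- covers.
    have h₃ : n ≤ 2 ^ (2 * C.depth) := h₂.trans (by
      rw [pow_mul]; exact Nat.pow_le_pow_left (by norm_num) _)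
    have h := hpow n _ hn h₃
    have h₁' : (n : ℝ) ≤ 3 * C.gateCount := by exact_mod_cast h₁
    push_cast at h
    constructor
    · linarith
    · linarith [(Nat.cast_nonneg C.depth : (0 : ℝ) ≤ C.depth)]
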